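/- Let $q$ be a prime power, $0<\varepsilon<1$ and $0<R<1$. For an $m\times n$ matrix $H$ over $\mathbb F_q$ let $C_H=\{\mathbf x\in\mathbb F_q^n: H\mathbf x^t=\mathbf 0\}$. A codeword chosen uniformly from $C_H$ is sent over the $q$-ary erasure channel, in which each symbol is independently erased with probability $\varepsilon$ and received correctly otherwise; call a codeword of $C_H$ a candidate if it agrees with the received word in all unerased positions. List decoding with list size $q^\ell$ fails if there are more than $q^\ell$ candidates, unambiguous decoding fails if there is more than one candidate, and maximum likelihood decoding outputs a codeword of maximal likelihood, chosen uniformly at random if there are several, and errs if it is not the one sent. Let $P_{\mathrm{ld}}(\mathcal R_{m,n},\ell,\varepsilon)$, $P_{\mathrm{ud}}(\mathcal R_{m,n},\varepsilon)$ and $P_{\mathrm{mld}}(\mathcal R_{m,n},\varepsilon)$ denote the respective failure or error probabilities, averaged over all $m\times n$ matrices $H$ over $\mathbb F_q$ with the uniform distribution. Let $m=m_n$ be non-negative integers with $m_n/n\to 1-R$ as $n\to\infty$ (for example $m_n=\lfloor(1-R)n\rfloor$, which is $(1-R)n$ whenever this is an integer). Then: 1. For every fixed integer $\ell\ge 0$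 the limit $T_{\mathrm{ld}}(\ell,\varepsilon)=-\lim_{n\to\infty}\frac1n\log_q P_{\mathrm{ld}}(\mathcal R_{m_n,n},\ell,\varepsilon)$ exists and $$T_{\mathrm{ld}}(\ell,\varepsilon)=\begin{cases}0 & (1-\varepsilon\le R<1)\\ (1-R)\log_q\left(\frac{1-R}{\varepsilon}\right)+R\log_q\left(\frac{R}{1-\varepsilon}\right) & \left(\frac{1-\varepsilon}{1-\varepsilon+q^{\ell+1}\varepsilon}<R<1-\varepsilon\right)\\ (\ell+1)(1-R)-\log_q\left(1-\varepsilon+q^{\ell+1}\varepsilon\right) & \left(0<R\le\frac{1-\varepsilon}{1-\varepsilon+q^{\ell+1}\varepsilon}\right).\end{cases}$$ 2. The limits $T_{\mathrm{ud}}(\varepsilon)=-\lim_{n\to\infty}\frac1n\log_q P_{\mathrm{ud}}(\mathcal R_{m_n,n},\varepsilon)$ and $T_{\mathrm{mld}}(\varepsilon)=-\lim_{n\to\infty}\frac1n\log_q P_{\mathrm{mld}}(\mathcal R_{m_n,n},\varepsilon)$ exist, and both are equal to the right-hand side of this formula for $\ell=0$. -/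

import Mathlib

open Filter Topology Finset
open scoped BigOperators

namespace ErasureChannel

variable {F : Type*} [Field F] [Fintype F]

/-- The parity-check code `C_H = {x ∈ F^n : H xᵗ = 0}` of an `m × n` matrix `H`. -/
def parityCheckCode {m n : ℕ} (H : Matrix (Fin m) (Fin n) F) : Submodule F (Fin n → F) :=
  LinearMap.ker H.mulVecLin

open Classical in
/-- Law of the memoryless `q`-ary erasure channel with erasure probability `ε`: the probability that
`y` is received when `x` is sent, where the output symbol `none` stands for an erasure. -/
noncomputable def transitionProb {n : ℕ} (ε : ℝ) (x : Fin n → F) (y : Fin n → Option F) : ℝ :=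
  ∏ i, if y i = none then ε else if y i = some (x i) then 1 - ε else 0

open Classical in
/-- The codewords of `C` that agree with the received word `y` in all positions not erased. -/
noncomputable def candidates {n : ℕ} (C : Submodule F (Fin n → F)) (y : Fin n → Option F) :
    Finset (Fin n → F) :=
  {x | x ∈ C ∧ ∀ i, y i = none ∨ y i = some (x i)}

open Classical in
/-- The codewords of `C` of maximal likelihood given the received word `y`. -/
noncomputable def mostLikely {n : ℕ} (C : Submodule F (Fin n → F)) (ε : ℝ)
    (y : Fin n → Option F) : Finset (Fin n → F) :=
  {x | x ∈ C ∧ ∀ x' ∈ C, transitionProb ε x' y ≤ transitionProb ε x y}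

open Classical in
/-- Unsuccessful decoding probability of `C` under list decoding with list size `L`, for a
uniformly distributed transmitted codeword: the decoder outputs the list of all candidates if there
are at most `L` of them, and fails otherwise. -/
noncomputable def listFailureProb {n : ℕ} (C : Submodule F (Fin n → F)) (L : ℕ) (ε : ℝ) : ℝ :=
  𝔼 c : C, ∑ y : Fin n → Option F,
    transitionProb ε (c : Fin n → F) y * (if #(candidates C y) ≤ L then 0 else 1)

open Classical in
/-- Unsuccessful decoding probability of `C` under unambiguous decoding, for a uniformly distributed
transmitted codeword: the decoder outputs the candidate if there is exactly one, and fails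
otherwise. -/
noncomputable def unambiguousFailureProb {n : ℕ} (C : Submodule F (Fin n → F)) (ε : ℝ) : ℝ :=
  𝔼 c : C, ∑ y : Fin n → Option F,
    transitionProb ε (c : Fin n → F) y * (if candidates C y = {(c : Fin n → F)} then 0 else 1)

open Classical in
/-- Decoding error probability of `C` under maximum likelihood decoding, for a uniformly distributed
transmitted codeword: the decoder outputs a codeword of maximal likelihood, chosen uniformly at
random if there are several. -/
noncomputable def mlErrorProb {n : ℕ} (C : Submodule F (Fin n → F)) (ε : ℝ) : ℝ :=
  𝔼 c : C, ∑ y : Fin n → Option F,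
    transitionProb ε (c : Fin n → F) y *
      (1 - if (c : Fin n → F) ∈ mostLikely C ε y then 1 / (#(mostLikely C ε y) : ℝ) else 0)

variable (F) in
open Classical in
/-- Average over the random matrix ensemble (all `m × n` matrices over `F`, uniformly distributed)
under list decoding with list size `q ^ ℓ`, where `q = |F|`. -/
noncomputable def avgListFailureProb (m n ℓ : ℕ) (ε : ℝ) : ℝ :=
  𝔼 H : Matrix (Fin m) (Fin n) F, listFailureProb (parityCheckCode H) (Fintype.card F ^ ℓ) ε

variable (F) in
open Classical in
/-- Average over the random matrix ensemble under unambiguous decoding. -/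
noncomputable def avgUnambiguousFailureProb (m n : ℕ) (ε : ℝ) : ℝ :=
  𝔼 H : Matrix (Fin m) (Fin n) F, unambiguousFailureProb (parityCheckCode H) ε

variable (F) in
open Classical in
/-- Average over the random matrix ensemble under maximum likelihood decoding. -/
noncomputable def avgMLErrorProb (m n : ℕ) (ε : ℝ) : ℝ :=
  𝔼 H : Matrix (Fin m) (Fin n) F, mlErrorProb (parityCheckCode H) ε

/-- The probabilities `P n` have error exponent `T`:
the limit `-lim (1/n) log_q (P n)` exists and equals `T`. -/
def HasErrorExponent (q : ℕ) (P : ℕ → ℝ) (T : ℝ) : Prop :=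
  Tendsto (fun n : ℕ => -(1 / (n : ℝ) * Real.logb q (P n))) atTop (𝓝 T)

/-- The piecewise formula for the exponent, as a function of `q`, `ℓ`, `ε` and the rate `R`. -/
noncomputable def exponentFormula (q ℓ : ℕ) (ε R : ℝ) : ℝ :=
  if 1 - ε ≤ R then 0
  else if (1 - ε) / (1 - ε + (q : ℝ) ^ (ℓ + 1) * ε) < R then
    (1 - R) * Real.logb q ((1 - R) / ε) + R * Real.logb q (R / (1 - ε))
  else
    ((ℓ : ℝ) + 1) * (1 - R) - Real.logb q (1 - ε + (q : ℝ) ^ (ℓ + 1) * ε)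

end ErasureChannel

/-! Fix the set `E` of erased positions. The candidates form a translate of the space of linear
relations among the columns of `H` indexed by `E`, so list decoding fails exactly when that space
has dimension greater than `ℓ`. Averaging over `H` leaves a sum over `E` of `erasureProb ε E` times
the probability that `#E` uniform vectors in `F^m` have more than `ℓ` independent relations. That
probability is `min(1, q^(-(ℓ+1)(m-#E)))` up to factors depending only on `q` and `ℓ`
(`rankDefectProb_mul_le`, `le_rankDefectProb`).

It remains to find the exponent of a binomial sum. From above, `min(1, q^((ℓ+1)(#E-m))) ≤
q^(s(#E-m))` for `0 ≤ s ≤ ℓ+1`, and the binomial theorem sums the right side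
(`avgListFailureProb_le`). From below, a single weight `i ≈ βn` is kept and its mass compared with
an atom of the binomial law of parameter `β` (`exists_binomial_atom`, `le_tilted_exponent`). The
bounds meet when `β = q^s ε / (1-ε+q^s ε)` for the optimal `s`; the three regimes are `s = 0`, `s`
interior and `s = ℓ+1`.

Unambiguous decoding is list decoding with `ℓ = 0`, and maximum likelihood decoding differs from it
by a factor between 1/2 and 1. -/

namespace ErasureChannel

/-! ### Linear relations among uniformly random vectors -/

section RankDefect

variable (F : Type*) {ι W : Type*} [Field F] [Fintype ι] [AddCommGroup W] [Module F W]

open Classical in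
/-- The families `ι → W` whose space of linear relations has dimension greater than `ℓ`. -/
noncomputable def rankDefective (ι W : Type*) [Fintype ι] [Fintype W] [AddCommGroup W] [Module F W]
    (ℓ : ℕ) : Finset (ι → W) :=
  {v | Set.finrank F (Set.range v) + ℓ < Fintype.card ι}

variable {F} in
theorem mem_rankDefective [Fintype W] {ℓ : ℕ} {v : ι → W} :
    v ∈ rankDefective F ι W ℓ ↔ Set.finrank F (Set.range v) + ℓ < Fintype.card ι := by
  classical
  simp [rankDefective]

variable {F} in
theorem finrank_range_add_finrank_ker_linearCombination (v : ι → W) :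
    Set.finrank F (Set.range v) + Module.finrank F (LinearMap.ker (Fintype.linearCombination F v)) =
      Fintype.card ι := by
  have h := LinearMap.finrank_range_add_finrank_ker (Fintype.linearCombination F v)
  rw [Fintype.range_linearCombination, Module.finrank_fintype_fun_eq_card] at h
  exact h

/-- Evaluation of a family of vectors on finitely many linear combinations. -/
def combine {κ : Type*} (t : κ → ι → F) : (ι → W) →ₗ[F] (κ → W) :=
  LinearMap.pi fun j => ∑ i, t j i • LinearMap.proj i

variable {F} in
theorem combine_apply {κ : Type*} (t : κ → ι → F) (v : ι → W) (j : κ) :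
    combine F t v j = Fintype.linearCombination F v (t j) := by
  simp [combine, Fintype.linearCombination_apply]

variable {F} in
-- A left inverse of `Fintype.linearCombination F t` extends the prescription `t j ↦ w j` to a
-- linear map on all of `ι → F`; its values on the standard basis are the required family.
theorem combine_surjective {κ : Type*} [Fintype κ] {t : κ → ι → F} (ht : LinearIndependent F t) :
    Function.Surjective (combine F t : (ι → W) →ₗ[F] (κ → W)) := by
  classical
  intro w
  obtain ⟨g, hg⟩ := LinearMap.exists_leftInverse_of_injective (Fintype.linearCombination F t)
    (LinearMap.ker_eq_bot.2 ht.fintypeLinearCombination_injective)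
  let f : (ι → F) →ₗ[F] W := Fintype.linearCombination F w ∘ₗ g
  refine ⟨fun i => f (Pi.single i 1), funext fun j => ?_⟩
  have h1 : g (t j) = Pi.single j 1 := by
    have := LinearMap.congr_fun hg (Pi.single j 1)
    simpa using this
  rw [combine_apply, Fintype.linearCombination_apply]
  have h2 : f (t j) = w j := by
    simp [f, h1]
  rw [← h2]
  conv_rhs => rw [pi_eq_sum_univ' (t j)]
  simp [map_sum]

variable {F} in
theorem card_ker_combine [Fintype F] [Fintype W] {κ : Type*} [Fintype κ] {t : κ → ι → F}
    (ht : LinearIndependent F t) :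
    Nat.card (LinearMap.ker (combine F t : (ι → W) →ₗ[F] (κ → W))) *
      Fintype.card F ^ (Fintype.card κ * Module.finrank F W) =
      Fintype.card F ^ (Fintype.card ι * Module.finrank F W) := by
  classical
  have h := LinearMap.finrank_range_add_finrank_ker (combine F t : (ι → W) →ₗ[F] (κ → W))
  rw [LinearMap.range_eq_top.2 (combine_surjective ht), finrank_top, Module.finrank_pi_fintype,
    Module.finrank_pi_fintype] at h
  simp only [sum_const, card_univ, smul_eq_mul] at h
  rw [Nat.card_eq_fintype_card, Module.card_eq_pow_finrank (K := F), ← pow_add, ← h, add_comm]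

/-- Union bound: a defective family satisfies some `ℓ + 1` independent relations, and each such
system cuts out a subspace of codimension `(ℓ + 1) * finrank F W`. The systems are counted crudely,
by all `(ℓ + 1)`-tuples of coefficient vectors. -/
theorem card_rankDefective_mul_le [Fintype F] [Fintype W] (ℓ : ℕ) :
    #(rankDefective F ι W ℓ) * Fintype.card F ^ ((ℓ + 1) * Module.finrank F W) ≤
      Fintype.card F ^ ((ℓ + 1) * Fintype.card ι) *
        Fintype.card F ^ (Fintype.card ι * Module.finrank F W) := by
  classical
  let T : Finset (Fin (ℓ + 1) → ι → F) := {t | LinearIndependent F t}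
  let K (t : Fin (ℓ + 1) → ι → F) : Finset (ι → W) :=
    {v | v ∈ LinearMap.ker (combine F t : (ι → W) →ₗ[F] (Fin (ℓ + 1) → W))}
  have hsub : rankDefective F ι W ℓ ⊆ T.biUnion K := by
    intro v hv
    rw [mem_rankDefective] at hv
    have h := finrank_range_add_finrank_ker_linearCombination (F := F) v
    obtain ⟨f, hf⟩ := exists_linearIndependent_of_le_finrank (R := F)
      (M := LinearMap.ker (Fintype.linearCombination F v)) (n := ℓ + 1) (by omega)
    simp only [mem_biUnion, T, K, mem_filter, mem_univ, true_and]
    refine ⟨fun j => f j, hf.map' (Submodule.subtype _) (Submodule.ker_subtype _), ?_⟩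
    rw [LinearMap.mem_ker]
    funext j
    rw [combine_apply]
    exact (f j).2
  have hK : ∀ t ∈ T, #(K t) * Fintype.card F ^ ((ℓ + 1) * Module.finrank F W) =
      Fintype.card F ^ (Fintype.card ι * Module.finrank F W) := by
    intro t ht
    have h := card_ker_combine (W := W) (t := t) (by simpa [T] using ht)
    rw [Fintype.card_fin] at h
    rw [← h, Nat.card_eq_fintype_card, Fintype.card_subtype]
  calc #(rankDefective F ι W ℓ) * Fintype.card F ^ ((ℓ + 1) * Module.finrank F W)
      ≤ (∑ t ∈ T, #(K t)) * Fintype.card F ^ ((ℓ + 1) * Module.finrank F W) :=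
        Nat.mul_le_mul_right _ ((card_le_card hsub).trans card_biUnion_le)
    _ = #T * Fintype.card F ^ (Fintype.card ι * Module.finrank F W) := by
        rw [sum_mul, sum_congr rfl hK, sum_const, smul_eq_mul]
    _ ≤ _ := by
        refine Nat.mul_le_mul_right _ ((card_le_univ T).trans_eq ?_)
        simp [← pow_mul, mul_comm]

/-- Defect 0 excluded means linearly independent. Appending `κ` combinations of an independent
family creates more than `ℓ` relations, and independence lets the coefficients be recovered, so the
construction is injective. -/
theorem card_linearIndependent_mul_le [Fintype F] [Fintype W] {κ : Type*} [Fintype κ] (ℓ : ℕ)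
    (hκ : ℓ < Fintype.card κ) :
    (Fintype.card F ^ (Fintype.card ι * Module.finrank F W) - #(rankDefective F ι W 0)) *
      Fintype.card F ^ (Fintype.card κ * Fintype.card ι) ≤ #(rankDefective F (ι ⊕ κ) W ℓ) := by
  classical
  have hcard : #((rankDefective F ι W 0)ᶜ ×ˢ (univ : Finset (κ → ι → F))) =
      (Fintype.card F ^ (Fintype.card ι * Module.finrank F W) - #(rankDefective F ι W 0)) *
      Fintype.card F ^ (Fintype.card κ * Fintype.card ι) := by
    rw [card_product, card_compl]
    simp [Module.card_eq_pow_finrank (K := F) (V := W), ← pow_mul, mul_comm]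
  rw [← hcard]
  refine card_le_card_of_injOn
    (fun p => Sum.elim p.1 fun j => Fintype.linearCombination F p.1 (p.2 j)) ?_ ?_
  · rintro ⟨v, a⟩ -
    rw [mem_coe, mem_rankDefective]
    have h1 : Submodule.span F (Set.range
        (Sum.elim v fun j => Fintype.linearCombination F v (a j))) ≤
        Submodule.span F (Set.range v) := by
      rw [Submodule.span_le]
      rintro _ ⟨i | j, rfl⟩
      · exact Submodule.subset_span ⟨i, rfl⟩
      · rw [← Fintype.range_linearCombination]
        exact ⟨a j, rfl⟩
    have h2 : Set.finrank F (Set.range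
        (Sum.elim v fun j => Fintype.linearCombination F v (a j))) ≤ Fintype.card ι :=
      (Submodule.finrank_mono h1).trans (finrank_range_le_card v)
    rw [Fintype.card_sum]
    exact Nat.add_lt_add_of_le_of_lt h2 hκ
  · rintro ⟨v, a⟩ hv ⟨v', a'⟩ - h
    have hli : LinearIndependent F v := by
      have := finrank_range_le_card (R := F) v
      simp only [coe_product, Set.mem_prod, mem_coe, mem_compl, mem_rankDefective] at hv
      rw [linearIndependent_iff_card_eq_finrank_span]
      omega
    have hvv : v = v' := by
      funext i
      exact congrFun h (Sum.inl i)
    subst hvv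
    have : a = a' := by
      funext j
      exact hli.fintypeLinearCombination_injective (congrFun h (Sum.inr j))
    rw [this]

theorem card_rankDefective_congr [Fintype W] {ι' : Type*} [Fintype ι'] (e : ι ≃ ι') (ℓ : ℕ) :
    #(rankDefective F ι W ℓ) = #(rankDefective F ι' W ℓ) := by
  classical
  refine card_equiv (e.arrowCongr (Equiv.refl W)) fun v => ?_
  rw [mem_rankDefective, mem_rankDefective, Fintype.card_congr e]
  have : Set.range (e.arrowCongr (Equiv.refl W) v) = Set.range v := by
    simp [Equiv.arrowCongr, e.symm.surjective.range_comp]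
  rw [this]

theorem mem_rankDefective_of_finrank_add_lt [Fintype W] {ℓ : ℕ}
    (h : Module.finrank F W + ℓ < Fintype.card ι) (v : ι → W) : v ∈ rankDefective F ι W ℓ := by
  rw [mem_rankDefective]
  have : Set.finrank F (Set.range v) ≤ Module.finrank F W := Submodule.finrank_le _
  omega

/-- Converse to the union bound, up to a constant: all but `ℓ + 1` of the vectors are chosen
independent and the rest in their span. The subtraction is truncated, so for at least `finrank F W`
vectors the bound is constant. -/
theorem pow_card_le_two_mul_card_rankDefective [Fintype F] [Fintype W] (ℓ : ℕ)
    (hℓ : ℓ < Fintype.card ι) :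
    Fintype.card F ^ (Fintype.card ι * Module.finrank F W) ≤
      2 * Fintype.card F ^ ((ℓ + 1) * (ℓ + 1)) *
      Fintype.card F ^ ((ℓ + 1) * (Module.finrank F W - Fintype.card ι)) *
      #(rankDefective F ι W ℓ) := by
  classical
  set q := Fintype.card F with hq
  set m := Module.finrank F W with hm
  set k := Fintype.card ι with hk
  have hq2 : 2 ≤ q := Fintype.one_lt_card
  rcases lt_or_ge (m + ℓ) k with h | h
  · rw [eq_univ_iff_forall.2 (mem_rankDefective_of_finrank_add_lt F h), card_univ, Fintype.card_fun,
      Module.card_eq_pow_finrank (K := F) (V := W), ← pow_mul, mul_comm m]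
    exact Nat.le_mul_of_pos_left _ (by positivity)
  · obtain ⟨r, hr⟩ : ∃ r, k = r + (ℓ + 1) := ⟨k - (ℓ + 1), by omega⟩
    have e : ι ≃ Fin r ⊕ Fin (ℓ + 1) := by
      refine Fintype.equivOfCardEq ?_
      simp [← hk, hr]
    have h1 := card_linearIndependent_mul_le F (ι := Fin r) (W := W) (κ := Fin (ℓ + 1)) ℓ (by simp)
    rw [← card_rankDefective_congr F e] at h1
    have h2 := card_rankDefective_mul_le F (ι := Fin r) (W := W) 0
    simp only [Fintype.card_fin, ← hm, ← hq, zero_add, one_mul] at h1 h2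
    -- Here `r < m`, so the union bound makes at most a fraction `1/q ≤ 1/2` of the families
    -- dependent.
    have h3 : 2 * #(rankDefective F (Fin r) W 0) ≤ q ^ (r * m) := by
      obtain ⟨d, hd⟩ : ∃ d, m = r + 1 + d := ⟨m - (r + 1), by omega⟩
      have hpos : 0 < q ^ r := by positivity
      have h4 : 2 ≤ q ^ (1 + d) := hq2.trans (by
        conv_lhs => rw [← pow_one q]
        exact Nat.pow_le_pow_right (by omega) (by omega))
      have h5 : q ^ m = q ^ r * q ^ (1 + d) := by rw [← pow_add, hd, add_assoc]
      rw [h5] at h2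
      have h6 : #(rankDefective F (Fin r) W 0) * q ^ (1 + d) ≤ q ^ (r * m) := by
        refine Nat.le_of_mul_le_mul_left ?_ hpos
        calc _ = #(rankDefective F (Fin r) W 0) * (q ^ r * q ^ (1 + d)) := by ring
          _ ≤ _ := h2
      nlinarith
    have h4 : q ^ (r * m) * q ^ ((ℓ + 1) * r) ≤ 2 * #(rankDefective F ι W ℓ) := by
      calc q ^ (r * m) * q ^ ((ℓ + 1) * r)
          ≤ (2 * (q ^ (r * m) - #(rankDefective F (Fin r) W 0))) * q ^ ((ℓ + 1) * r) :=
            Nat.mul_le_mul_right _ (by omega)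
        _ ≤ _ := by rw [mul_assoc]; exact Nat.mul_le_mul_left _ h1
    calc q ^ (k * m) ≤ q ^ ((ℓ + 1) * (ℓ + 1) + (ℓ + 1) * (m - k) + (r * m + (ℓ + 1) * r)) := by
          refine Nat.pow_le_pow_right (by omega) ?_
          -- Passing from `m - r` to the truncated `m - k` costs at most `ℓ + 1`, hence the constant
          -- `q ^ ((ℓ + 1) * (ℓ + 1))`.
          have : m ≤ (ℓ + 1) + (m - k) + r := by omega
          calc k * m = r * m + (ℓ + 1) * m := by rw [hr]; ring
            _ ≤ r * m + (ℓ + 1) * ((ℓ + 1) + (m - k) + r) := by gcongr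
            _ = _ := by ring
      _ = q ^ ((ℓ + 1) * (ℓ + 1)) * q ^ ((ℓ + 1) * (m - k)) *
            (q ^ (r * m) * q ^ ((ℓ + 1) * r)) := by rw [pow_add, pow_add, pow_add (q) (r * m)]
      _ ≤ q ^ ((ℓ + 1) * (ℓ + 1)) * q ^ ((ℓ + 1) * (m - k)) * (2 * #(rankDefective F ι W ℓ)) :=
          Nat.mul_le_mul_left _ h4
      _ = _ := by ring

open Classical in
/-- The probability that a uniformly random family `ι → W` has a space of linear relations of
dimension greater than `ℓ`. -/
noncomputable def rankDefectProb (ι W : Type*) [Fintype ι] [Fintype W] [AddCommGroup W]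
    [Module F W] (ℓ : ℕ) : ℝ :=
  𝔼 v : ι → W, if v ∈ rankDefective F ι W ℓ then 1 else 0

theorem rankDefectProb_eq_div [Fintype F] [Fintype W] (ℓ : ℕ) :
    rankDefectProb F ι W ℓ = #(rankDefective F ι W ℓ) /
      (Fintype.card F : ℝ) ^ (Fintype.card ι * Module.finrank F W) := by
  classical
  rw [rankDefectProb, Fintype.expect_eq_sum_div_card]
  congr 1
  · simp
  · rw [Fintype.card_fun, Module.card_eq_pow_finrank (K := F) (V := W), ← pow_mul, mul_comm]
    push_cast
    rfl

theorem rankDefectProb_nonneg [Fintype W] (ℓ : ℕ) : 0 ≤ rankDefectProb F ι W ℓ := by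
  refine expect_nonneg fun v _ => ?_
  split_ifs <;> norm_num

theorem rankDefectProb_le_one [Fintype W] (ℓ : ℕ) : rankDefectProb F ι W ℓ ≤ 1 := by
  classical
  refine (expect_le_expect (g := fun _ => (1 : ℝ)) fun v _ => ?_).trans_eq
    (Fintype.expect_const _)
  split_ifs <;> norm_num

theorem rankDefectProb_mul_le [Fintype F] [Fintype W] (ℓ : ℕ) :
    rankDefectProb F ι W ℓ * (Fintype.card F : ℝ) ^ ((ℓ + 1) * Module.finrank F W) ≤
      (Fintype.card F : ℝ) ^ ((ℓ + 1) * Fintype.card ι) := by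
  have hq : (0 : ℝ) < Fintype.card F := by exact_mod_cast Fintype.card_pos
  rw [rankDefectProb_eq_div, div_mul_eq_mul_div, div_le_iff₀ (by positivity)]
  exact_mod_cast card_rankDefective_mul_le F (ι := ι) (W := W) ℓ

theorem le_rankDefectProb [Fintype F] [Fintype W] (ℓ : ℕ) (hℓ : ℓ < Fintype.card ι) :
    1 / (2 * (Fintype.card F : ℝ) ^ ((ℓ + 1) * (ℓ + 1))) /
      (Fintype.card F : ℝ) ^ ((ℓ + 1) * (Module.finrank F W - Fintype.card ι)) ≤
      rankDefectProb F ι W ℓ := by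
  have hq : (0 : ℝ) < Fintype.card F := by exact_mod_cast Fintype.card_pos
  rw [rankDefectProb_eq_div, div_div, div_le_div_iff₀ (by positivity) (by positivity), one_mul,
    mul_comm (#(rankDefective F ι W ℓ) : ℝ)]
  exact_mod_cast pow_card_le_two_mul_card_rankDefective F (ι := ι) (W := W) ℓ hℓ

open Classical in
theorem expect_restrict_mem_rankDefective [Fintype W] (E : Finset ι) (ℓ : ℕ) :
    (𝔼 v : ι → W, if (fun i : E => v i) ∈ rankDefective F E W ℓ then (1 : ℝ) else 0) =
      rankDefectProb F E W ℓ := by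
  let e : (ι → W) ≃ (E → W) × ({i // i ∉ E} → W) :=
    Equiv.piEquivPiSubtypeProd (fun i => i ∈ E) fun _ => W
  refine (Fintype.expect_equiv e _
    (fun p => if p.1 ∈ rankDefective F E W ℓ then (1 : ℝ) else 0) fun v => rfl).trans ?_
  rw [← univ_product_univ, expect_product]
  rw [rankDefectProb]
  refine expect_congr (by ext; simp) fun v _ => ?_
  exact Fintype.expect_const (if v ∈ rankDefective F E W ℓ then (1 : ℝ) else 0)

end RankDefect

end ErasureChannel

namespace ErasureChannel

/-! ### From decoding failure to rank defects -/

section Decoding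

variable {F : Type*} {n : ℕ}

/-- The word received when `x` is sent and exactly the positions in `E` are erased. -/
def erase (x : Fin n → F) (E : Finset (Fin n)) : Fin n → Option F :=
  fun i => if i ∈ E then none else some (x i)

theorem erase_eq_none {x : Fin n → F} {E : Finset (Fin n)} {i : Fin n} :
    erase x E i = none ↔ i ∈ E := by
  simp [erase]

theorem erase_injective (x : Fin n → F) : Function.Injective (erase x) := by
  intro E E' h
  ext i
  rw [← erase_eq_none (x := x), h, erase_eq_none]

/-- The probability that exactly the positions in `E` are erased. -/
def erasureProb (ε : ℝ) (E : Finset (Fin n)) : ℝ :=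
  ε ^ #E * (1 - ε) ^ (n - #E)

theorem erasureProb_pos {ε : ℝ} (hε₀ : 0 < ε) (hε₁ : ε < 1) (E : Finset (Fin n)) :
    0 < erasureProb ε E := by
  have : 0 < 1 - ε := by linarith
  unfold erasureProb
  positivity

theorem transitionProb_eq_prod_of_agree {ε : ℝ} {x c : Fin n → F} {E : Finset (Fin n)}
    (h : ∀ i, i ∈ E ∨ c i = x i) : transitionProb ε x (erase c E) = erasureProb ε E := by
  classical
  have h1 : ∀ i, (if erase c E i = none then ε else if erase c E i = some (x i) then 1 - ε else 0) =
      if i ∈ E then ε else 1 - ε := by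
    intro i
    by_cases hi : i ∈ E
    · simp [erase, hi]
    · have := (h i).resolve_left hi
      simp [erase, hi, this]
  unfold transitionProb erasureProb
  have h2 : ({i | i ∉ E} : Finset (Fin n)) = Eᶜ := by ext; simp
  rw [prod_congr rfl fun i _ => h1 i, prod_ite, prod_const, prod_const, filter_mem_eq_inter,
    univ_inter, h2, card_compl, Fintype.card_fin]

theorem transitionProb_eq_zero {ε : ℝ} {x : Fin n → F} {y : Fin n → Option F} {i : Fin n}
    (h : y i ≠ none) (h' : y i ≠ some (x i)) : transitionProb ε x y = 0 := by
  classical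
  unfold transitionProb
  exact prod_eq_zero (mem_univ i) (by rw [if_neg h, if_neg h'])

/-- Words other than the `erase x E` have probability zero, so the channel output amounts to an
erasure pattern. -/
theorem sum_transitionProb_mul [Fintype F] (ε : ℝ) (x : Fin n → F) (f : (Fin n → Option F) → ℝ) :
    ∑ y, transitionProb ε x y * f y = ∑ E, erasureProb ε E * f (erase x E) := by
  classical
  symm
  refine Fintype.sum_of_injective (erase x) (erase_injective x) _ _ (fun y hy => ?_) fun E => ?_
  · have : ∃ i, y i ≠ none ∧ y i ≠ some (x i) := by
      by_contra! hcon
      refine hy ⟨univ.filter fun i => y i = none, funext fun i => ?_⟩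
      by_cases hi : y i = none
      · simp [erase, hi]
      · simp [erase, hcon i hi]
    obtain ⟨i, h1, h2⟩ := this
    rw [transitionProb_eq_zero h1 h2, zero_mul]
  · rw [transitionProb_eq_prod_of_agree fun i => Or.inr rfl]

variable [Field F]

theorem mem_candidates_erase [Fintype F] {C : Submodule F (Fin n → F)} {x c : Fin n → F}
    {E : Finset (Fin n)} :
    x ∈ candidates C (erase c E) ↔ x ∈ C ∧ ∀ i, i ∈ E ∨ c i = x i := by
  classical
  rw [candidates, mem_filter]
  refine (and_iff_right (mem_univ x)).trans (and_congr_right fun _ => forall_congr' fun i => ?_)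
  by_cases hi : i ∈ E <;> simp [erase, hi]

/-- The likelihood takes only the values 0 and `erasureProb ε E > 0`, the latter exactly at words
agreeing off `E`; the sent word attains it. -/
theorem mostLikely_erase [Fintype F] {C : Submodule F (Fin n → F)} {c : Fin n → F} (hc : c ∈ C)
    {ε : ℝ} (hε₀ : 0 < ε) (hε₁ : ε < 1) (E : Finset (Fin n)) :
    mostLikely C ε (erase c E) = candidates C (erase c E) := by
  have hpos := erasureProb_pos hε₀ hε₁ E
  have hle : ∀ x, transitionProb ε x (erase c E) ≤ erasureProb ε E := by
    intro x
    by_cases h : ∀ i, i ∈ E ∨ c i = x i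
    · rw [transitionProb_eq_prod_of_agree h]
    · push Not at h
      obtain ⟨i, h1, h2⟩ := h
      rw [transitionProb_eq_zero (i := i) (by rwa [ne_eq, erase_eq_none]) (by simp [erase, h1, h2])]
      exact hpos.le
  ext x
  rw [mem_candidates_erase]
  simp only [mostLikely, mem_filter, mem_univ, true_and]
  refine and_congr_right fun _ => ⟨fun h => ?_, fun h x' _ => ?_⟩
  · have h1 := h c hc
    rw [transitionProb_eq_prod_of_agree (x := c) fun i => Or.inr rfl] at h1
    by_contra! hcon
    obtain ⟨i, h2, h3⟩ := hcon
    rw [transitionProb_eq_zero (i := i) (by rwa [ne_eq, erase_eq_none])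
      (by simp [erase, h2, h3])] at h1
    linarith
  · rw [transitionProb_eq_prod_of_agree h]
    exact hle x'

theorem mulVec_eq_linearCombination {m : ℕ} (H : Matrix (Fin m) (Fin n) F) {E : Finset (Fin n)}
    {x : Fin n → F} (hx : ∀ i ∉ E, x i = 0) :
    H.mulVec x = Fintype.linearCombination F (fun i : E => H.transpose i) (fun i => x i) := by
  rw [Matrix.mulVec_eq_sum, Fintype.linearCombination_apply]
  symm
  refine Fintype.sum_of_injective (Subtype.val : E → Fin n) Subtype.val_injective _ _ ?_ ?_
  · intro i hi
    rw [hx i (by simpa using hi)]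
    simp
  · intro i
    rw [op_smul_eq_smul]

/-- Subtracting `c` turns candidates into codewords supported in `E`, which are the relations among
the columns indexed by `E`. -/
theorem card_candidates_erase [Fintype F] {m : ℕ} (H : Matrix (Fin m) (Fin n) F) {c : Fin n → F}
    (hc : c ∈ parityCheckCode H) (E : Finset (Fin n)) :
    #(candidates (parityCheckCode H) (erase c E)) = Fintype.card F ^ Module.finrank F
      (LinearMap.ker (Fintype.linearCombination F fun i : E => H.transpose i)) := by
  classical
  rw [← Module.card_eq_pow_finrank, Fintype.card_subtype]
  have hmem : ∀ x, x ∈ parityCheckCode H ↔ H.mulVec x = 0 := fun x => by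
    simp [parityCheckCode, LinearMap.mem_ker]
  rw [hmem] at hc
  refine card_bij' (fun x _ i => x i - c i)
    (fun z _ i => c i + if h : i ∈ E then z ⟨i, h⟩ else 0) ?_ ?_ ?_ ?_
  · intro x hx
    rw [mem_candidates_erase, hmem] at hx
    simp only [mem_filter, mem_univ, true_and, LinearMap.mem_ker]
    have := mulVec_eq_linearCombination H (E := E) (x := x - c)
      fun i hi => by simp [(hx.2 i).resolve_left hi]
    rw [Matrix.mulVec_sub, hx.1, hc, sub_zero] at this
    exact this.symm
  · intro z hz
    simp only [mem_filter, mem_univ, true_and, LinearMap.mem_ker] at hz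
    rw [mem_candidates_erase, hmem]
    refine ⟨?_, fun i => ?_⟩
    · have := mulVec_eq_linearCombination H (E := E)
        (x := fun i => if h : i ∈ E then z ⟨i, h⟩ else 0) fun i hi => by simp [hi]
      simp only [coe_mem, dite_true, Subtype.coe_eta, hz] at this
      change H.mulVec (c + fun i => if h : i ∈ E then z ⟨i, h⟩ else 0) = 0
      rw [Matrix.mulVec_add, hc, this, add_zero]
    · by_cases hi : i ∈ E <;> simp [hi]
  · intro x hx
    rw [mem_candidates_erase] at hx
    funext i
    by_cases hi : i ∈ E
    · simp [hi]
    · simp [hi, (hx.2 i).resolve_left hi]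
  · intro z _
    funext i
    simp

theorem card_candidates_erase_le_iff [Fintype F] {m : ℕ} (H : Matrix (Fin m) (Fin n) F)
    {c : Fin n → F} (hc : c ∈ parityCheckCode H) (E : Finset (Fin n)) (ℓ : ℕ) :
    #(candidates (parityCheckCode H) (erase c E)) ≤ Fintype.card F ^ ℓ ↔
      (fun i : E => H.transpose i) ∉ rankDefective F E (Fin m → F) ℓ := by
  have h := finrank_range_add_finrank_ker_linearCombination (F := F) fun i : E => H.transpose i
  rw [card_candidates_erase H hc, Nat.pow_le_pow_iff_right Fintype.one_lt_card, mem_rankDefective]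
  omega

open Classical in
theorem listFailureProb_eq [Fintype F] {m : ℕ} (H : Matrix (Fin m) (Fin n) F) (ℓ : ℕ) (ε : ℝ) :
    listFailureProb (parityCheckCode H) (Fintype.card F ^ ℓ) ε = ∑ E : Finset (Fin n), erasureProb ε E *
      if (fun i : E => H.transpose i) ∈ rankDefective F E (Fin m → F) ℓ then 1 else 0 := by
  unfold listFailureProb
  have h : ∀ c : parityCheckCode H, (∑ y : Fin n → Option F, transitionProb ε (c : Fin n → F) y *
      (if #(candidates (parityCheckCode H) y) ≤ Fintype.card F ^ ℓ then 0 else 1)) =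
      ∑ E : Finset (Fin n), erasureProb ε E *
      if (fun i : E => H.transpose i) ∈ rankDefective F E (Fin m → F) ℓ then 1 else 0 := by
    intro c
    rw [sum_transitionProb_mul]
    refine sum_congr rfl fun E _ => ?_
    simp only [card_candidates_erase_le_iff H c.2 E ℓ, ite_not]
  rw [expect_congr rfl fun c _ => h c]
  exact Fintype.expect_const _

theorem avgListFailureProb_eq [Fintype F] (m n ℓ : ℕ) (ε : ℝ) :
    avgListFailureProb F m n ℓ ε = ∑ E : Finset (Fin n), erasureProb ε E *
      rankDefectProb F E (Fin m → F) ℓ := by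
  classical
  unfold avgListFailureProb
  rw [expect_congr rfl fun H _ => listFailureProb_eq H ℓ ε, expect_sum_comm]
  refine sum_congr rfl fun E _ => ?_
  rw [← mul_expect, ← expect_restrict_mem_rankDefective]
  congr 1
  let e : Matrix (Fin m) (Fin n) F ≃ (Fin n → Fin m → F) :=
    ⟨Matrix.transpose, Matrix.transpose, fun _ => rfl, fun _ => rfl⟩
  have := Fintype.expect_equiv e
    (fun H => if (fun i : E => H.transpose i) ∈ rankDefective F E (Fin m → F) ℓ then (1 : ℝ) else 0)
    (fun v => if (fun i : E => v i) ∈ rankDefective F E (Fin m → F) ℓ then (1 : ℝ) else 0)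
    fun H => rfl
  convert this

theorem self_mem_candidates_erase [Fintype F] {C : Submodule F (Fin n → F)} {c : Fin n → F}
    (hc : c ∈ C) (E : Finset (Fin n)) : c ∈ candidates C (erase c E) :=
  mem_candidates_erase.2 ⟨hc, fun _ => Or.inr rfl⟩

theorem unambiguousFailureProb_eq [Fintype F] (C : Submodule F (Fin n → F)) (ε : ℝ) :
    unambiguousFailureProb C ε = listFailureProb C 1 ε := by
  classical
  unfold unambiguousFailureProb listFailureProb
  refine expect_congr rfl fun c _ => ?_
  rw [sum_transitionProb_mul, sum_transitionProb_mul]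
  refine sum_congr rfl fun E _ => ?_
  have hc := self_mem_candidates_erase c.2 E
  have : candidates C (erase (c : Fin n → F) E) = {(c : Fin n → F)} ↔
      #(candidates C (erase (c : Fin n → F) E)) ≤ 1 :=
    ⟨fun h => by rw [h, card_singleton], fun h => (eq_of_subset_of_card_le
      (singleton_subset_iff.2 hc) (by rwa [card_singleton])).symm⟩
  simp only [this]

theorem avgUnambiguousFailureProb_eq [Fintype F] (m n : ℕ) (ε : ℝ) :
    avgUnambiguousFailureProb F m n ε = avgListFailureProb F m n 0 ε := by
  unfold avgUnambiguousFailureProb avgListFailureProb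
  simp only [unambiguousFailureProb_eq, pow_zero]

/-- With `N` candidates the error probability is `1 - 1/N`: zero for `N = 1`, between 1/2 and 1
otherwise. -/
theorem mlErrorProb_bounds [Fintype F] (C : Submodule F (Fin n → F)) {ε : ℝ} (hε₀ : 0 < ε)
    (hε₁ : ε < 1) :
    1 / 2 * listFailureProb C 1 ε ≤ mlErrorProb C ε ∧ mlErrorProb C ε ≤ listFailureProb C 1 ε := by
  classical
  unfold mlErrorProb listFailureProb
  have key : ∀ (c : C) (E : Finset (Fin n)),
      1 / 2 * (if #(candidates C (erase (c : Fin n → F) E)) ≤ 1 then (0 : ℝ) else 1) ≤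
        (1 - if (c : Fin n → F) ∈ mostLikely C ε (erase c E) then
          1 / (#(mostLikely C ε (erase (c : Fin n → F) E)) : ℝ) else 0) ∧
      (1 - if (c : Fin n → F) ∈ mostLikely C ε (erase c E) then
          1 / (#(mostLikely C ε (erase (c : Fin n → F) E)) : ℝ) else 0) ≤
        if #(candidates C (erase (c : Fin n → F) E)) ≤ 1 then (0 : ℝ) else 1 := by
    intro c E
    have hc := self_mem_candidates_erase c.2 E
    rw [mostLikely_erase c.2 hε₀ hε₁, if_pos hc]
    have hpos := card_pos.2 ⟨_, hc⟩
    split_ifs with h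
    · have : #(candidates C (erase (c : Fin n → F) E)) = 1 := by omega
      norm_num [this]
    · have h2 : (2 : ℝ) ≤ #(candidates C (erase (c : Fin n → F) E)) := by
        exact_mod_cast (by omega : 2 ≤ #(candidates C (erase (c : Fin n → F) E)))
      have h3 := one_div_le_one_div_of_le (by norm_num) h2
      have h4 : (0 : ℝ) ≤ 1 / #(candidates C (erase (c : Fin n → F) E)) := by positivity
      constructor <;> linarith
  constructor
  · rw [mul_expect]
    refine expect_le_expect fun c _ => ?_
    rw [sum_transitionProb_mul, sum_transitionProb_mul, mul_sum]
    refine sum_le_sum fun E _ => ?_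
    rw [mul_left_comm]
    exact mul_le_mul_of_nonneg_left (key c E).1 (erasureProb_pos hε₀ hε₁ E).le
  · refine expect_le_expect fun c _ => ?_
    rw [sum_transitionProb_mul, sum_transitionProb_mul]
    refine sum_le_sum fun E _ => ?_
    exact mul_le_mul_of_nonneg_left (key c E).2 (erasureProb_pos hε₀ hε₁ E).le

theorem avgMLErrorProb_bounds [Fintype F] (m n : ℕ) {ε : ℝ} (hε₀ : 0 < ε) (hε₁ : ε < 1) :
    1 / 2 * avgListFailureProb F m n 0 ε ≤ avgMLErrorProb F m n ε ∧
      avgMLErrorProb F m n ε ≤ avgListFailureProb F m n 0 ε := by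
  unfold avgMLErrorProb avgListFailureProb
  rw [pow_zero]
  constructor
  · rw [mul_expect]
    exact expect_le_expect fun H _ => (mlErrorProb_bounds _ hε₀ hε₁).1
  · exact expect_le_expect fun H _ => (mlErrorProb_bounds _ hε₀ hε₁).2

/-! ### Bounds on the average failure probability for finite length -/

theorem avgListFailureProb_le [Fintype F] (m n ℓ : ℕ) {ε : ℝ} (hε₀ : 0 < ε) (hε₁ : ε < 1) {s : ℝ}
    (hs₀ : 0 ≤ s) (hs₁ : s ≤ ℓ + 1) :
    avgListFailureProb F m n ℓ ε ≤ (Fintype.card F : ℝ) ^ (-(s * m)) *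
      (1 - ε + (Fintype.card F : ℝ) ^ s * ε) ^ n := by
  set q : ℝ := (Fintype.card F : ℝ) with hq
  have hq1 : 1 < q := Nat.one_lt_cast.2 Fintype.one_lt_card
  have hq0 : 0 < q := by linarith
  have hE : ∀ E : Finset (Fin n),
      rankDefectProb F E (Fin m → F) ℓ ≤ q ^ (-(s * m)) * (q ^ s) ^ #E := by
    intro E
    have h1 := rankDefectProb_le_one F (ι := E) (W := Fin m → F) ℓ
    have h2 := rankDefectProb_mul_le F (ι := E) (W := Fin m → F) ℓ
    rw [Module.finrank_fin_fun, Fintype.card_coe, ← hq] at h2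
    rw [← Real.rpow_mul_natCast hq0.le, ← Real.rpow_add hq0]
    -- For `#E ≥ m` the trivial bound 1 suffices because `s ≥ 0`; otherwise the union bound suffices
    -- because `s ≤ ℓ + 1`.
    rcases le_total m #E with h | h
    · refine h1.trans (Real.one_le_rpow hq1.le ?_)
      have : (m : ℝ) ≤ #E := by exact_mod_cast h
      nlinarith
    · rw [← le_div_iff₀ (by positivity), ← Real.rpow_natCast, ← Real.rpow_natCast,
        ← Real.rpow_sub hq0] at h2
      refine h2.trans (Real.rpow_le_rpow_of_exponent_le hq1.le ?_)
      have : (#E : ℝ) ≤ m := by exact_mod_cast h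
      push_cast
      nlinarith
  have hsum := Fintype.sum_pow_mul_eq_add_pow (Fin n) (q ^ s * ε) (1 - ε)
  rw [Fintype.card_fin] at hsum
  rw [avgListFailureProb_eq, add_comm, ← hsum, mul_sum]
  refine sum_le_sum fun E _ => ?_
  refine (mul_le_mul_of_nonneg_left (hE E) (erasureProb_pos hε₀ hε₁ E).le).trans_eq ?_
  rw [erasureProb, mul_pow]
  ring

/-- Only the erasure patterns of weight `i` are kept. -/
theorem le_avgListFailureProb [Fintype F] (m n ℓ : ℕ) {ε : ℝ} (hε₀ : 0 < ε) (hε₁ : ε < 1) {i : ℕ}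
    (hi : ℓ < i) :
    1 / (2 * (Fintype.card F : ℝ) ^ ((ℓ + 1) * (ℓ + 1))) *
      ((n.choose i * ε ^ i * (1 - ε) ^ (n - i)) / (Fintype.card F : ℝ) ^ ((ℓ + 1) * (m - i))) ≤
      avgListFailureProb F m n ℓ ε := by
  rw [avgListFailureProb_eq]
  refine le_trans ?_ (sum_le_sum_of_subset_of_nonneg (subset_univ (powersetCard i univ))
    fun E _ _ => mul_nonneg (erasureProb_pos hε₀ hε₁ E).le (rankDefectProb_nonneg F ℓ))
  have h : ∀ E ∈ powersetCard i (univ : Finset (Fin n)),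
      ε ^ i * (1 - ε) ^ (n - i) * (1 / (2 * (Fintype.card F : ℝ) ^ ((ℓ + 1) * (ℓ + 1))) /
        (Fintype.card F : ℝ) ^ ((ℓ + 1) * (m - i))) ≤
      erasureProb ε E * rankDefectProb F E (Fin m → F) ℓ := by
    intro E hE
    rw [mem_powersetCard_univ] at hE
    have h1 := le_rankDefectProb F (ι := E) (W := Fin m → F) ℓ (by rwa [Fintype.card_coe, hE])
    rw [Module.finrank_fin_fun, Fintype.card_coe, hE] at h1
    have h2 := (erasureProb_pos hε₀ hε₁ E).le
    refine (mul_le_mul_of_nonneg_left h1 h2).trans' (le_of_eq ?_)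
    rw [erasureProb, hE]
  refine (sum_le_sum h).trans' (le_of_eq ?_)
  rw [sum_const, card_powersetCard, card_univ, Fintype.card_fin, nsmul_eq_mul]
  ring

end Decoding

end ErasureChannel

namespace ErasureChannel

/-! ### Asymptotics of the binomial sum -/

section Exponent

theorem sum_binomial_variance (n : ℕ) (β : ℝ) :
    ∑ i ∈ range (n + 1), ((i : ℝ) - n * β) ^ 2 * (n.choose i * β ^ i * (1 - β) ^ (n - i)) =
      n * β * (1 - β) := by
  have h := congrArg (Polynomial.eval β) (bernsteinPolynomial.variance ℝ n)
  simp only [Polynomial.eval_finsetSum, bernsteinPolynomial, Polynomial.eval_mul,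
    Polynomial.eval_pow, Polynomial.eval_sub, Polynomial.eval_natCast, Polynomial.eval_X,
    Polynomial.eval_one, nsmul_eq_mul] at h
  rw [← h]
  refine sum_congr rfl fun i _ => ?_
  ring

/-- A binomial distribution has an atom near its mean whose mass is at least inversely linear. -/
theorem exists_binomial_atom {n : ℕ} (hn : 0 < n) {β : ℝ} (hβ₀ : 0 < β) (hβ₁ : β < 1) :
    ∃ i ≤ n, ((i : ℝ) - n * β) ^ 2 ≤ 2 * n ∧
      1 / (2 * ((n : ℝ) + 1)) ≤ n.choose i * β ^ i * (1 - β) ^ (n - i) := by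
  by_contra! hcon
  have hn' : (0 : ℝ) < n := by exact_mod_cast hn
  have hβ : 0 < 1 - β := by linarith
  -- Chebyshev's argument: near the mean the first term bounds the mass by assumption, far from it
  -- the second does. Summation gives `1 ≤ 1/2 + β(1-β)/2`, which is impossible as `β(1-β) ≤ 1/4`.
  have hle : ∀ i ∈ range (n + 1), (n.choose i * β ^ i * (1 - β) ^ (n - i) : ℝ) ≤
      1 / (2 * ((n : ℝ) + 1)) +
        ((i : ℝ) - n * β) ^ 2 * (n.choose i * β ^ i * (1 - β) ^ (n - i)) / (2 * n) := by
    intro i hi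
    have hb : (0 : ℝ) ≤ n.choose i * β ^ i * (1 - β) ^ (n - i) := by positivity
    by_cases h : ((i : ℝ) - n * β) ^ 2 ≤ 2 * n
    · have h1 := hcon i (by simpa [Nat.lt_succ_iff] using hi) h
      have : 0 ≤ ((i : ℝ) - n * β) ^ 2 * (n.choose i * β ^ i * (1 - β) ^ (n - i)) / (2 * n) := by
        positivity
      linarith
    · push Not at h
      have h1 : (0 : ℝ) ≤ 1 / (2 * ((n : ℝ) + 1)) := by positivity
      have h2 : (n.choose i * β ^ i * (1 - β) ^ (n - i) : ℝ) ≤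
          ((i : ℝ) - n * β) ^ 2 * (n.choose i * β ^ i * (1 - β) ^ (n - i)) / (2 * n) := by
        rw [le_div_iff₀ (by positivity), mul_comm]
        exact mul_le_mul_of_nonneg_right h.le hb
      linarith
  have hone : ∑ i ∈ range (n + 1), (n.choose i * β ^ i * (1 - β) ^ (n - i) : ℝ) = 1 := by
    have := add_pow β (1 - β) n
    rw [add_sub_cancel, one_pow] at this
    exact (sum_congr rfl fun i _ => by ring).trans this.symm
  have hsum := sum_le_sum hle
  rw [hone, sum_add_distrib, sum_const, card_range, nsmul_eq_mul, ← sum_div,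
    sum_binomial_variance] at hsum
  have h1 : ((n + 1 : ℕ) : ℝ) * (1 / (2 * ((n : ℝ) + 1))) = 1 / 2 := by
    push_cast
    field_simp
  have h2 : (n : ℝ) * β * (1 - β) / (2 * n) = β * (1 - β) / 2 := by
    field_simp
  rw [h1, h2] at hsum
  nlinarith [sq_nonneg (β - 1 / 2)]

theorem tendsto_logb_add_one_div (b : ℝ) :
    Tendsto (fun n : ℕ => Real.logb b ((n : ℝ) + 1) / n) atTop (𝓝 0) := by
  have h := (Real.tendsto_pow_log_div_mul_add_atTop 1 (-1) 1 one_ne_zero).comp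
    (tendsto_atTop_add_const_right _ 1 tendsto_natCast_atTop_atTop)
  have h2 := h.div_const (Real.log b)
  rw [zero_div] at h2
  refine h2.congr fun n => ?_
  simp only [Function.comp_apply, pow_one, Real.logb]
  rw [one_mul, add_neg_cancel_right, div_right_comm]

/-- Positions `i n` with `i n / n → β` at which the binomial distribution is not too small. -/
theorem exists_binomial_atoms {β : ℝ} (hβ₀ : 0 < β) (hβ₁ : β < 1) :
    ∃ i : ℕ → ℕ, Tendsto (fun n => (i n : ℝ) / n) atTop (𝓝 β) ∧ ∀ n, 0 < n → i n ≤ n ∧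
      1 / (2 * ((n : ℝ) + 1)) ≤ n.choose (i n) * β ^ i n * (1 - β) ^ (n - i n) := by
  have h : ∀ n : ℕ, ∃ i : ℕ, 0 < n → i ≤ n ∧ ((i : ℝ) - n * β) ^ 2 ≤ 2 * n ∧
      1 / (2 * ((n : ℝ) + 1)) ≤ n.choose i * β ^ i * (1 - β) ^ (n - i) := by
    intro n
    rcases Nat.eq_zero_or_pos n with rfl | hn
    · exact ⟨0, fun h => absurd h (lt_irrefl _)⟩
    · obtain ⟨i, hi⟩ := exists_binomial_atom hn hβ₀ hβ₁
      exact ⟨i, fun _ => hi⟩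
  choose i hi using h
  refine ⟨i, ?_, fun n hn => ⟨(hi n hn).1, (hi n hn).2.2⟩⟩
  have hsqrt : Tendsto (fun n : ℕ => √(2 / (n : ℝ))) atTop (𝓝 0) := by
    have := (tendsto_const_div_atTop_nhds_zero_nat (2 : ℝ)).sqrt
    rwa [Real.sqrt_zero] at this
  refine tendsto_iff_norm_sub_tendsto_zero.2 (squeeze_zero' (Eventually.of_forall fun n =>
    norm_nonneg _) ?_ hsqrt)
  filter_upwards [eventually_gt_atTop 0] with n hn
  have hn' : (0 : ℝ) < n := by exact_mod_cast hn
  rw [Real.norm_eq_abs]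
  refine Real.abs_le_sqrt ?_
  have h1 : (i n : ℝ) / n - β = (i n - n * β) / n := by field_simp
  rw [h1, div_pow, div_le_div_iff₀ (by positivity) hn']
  nlinarith [(hi n hn).2.1]

variable {q ℓ : ℕ} {ε R : ℝ} {m : ℕ → ℕ} {P : ℕ → ℝ}

theorem chernoff_exponent_le (hq : 1 < q) (hε₀ : 0 < ε) (hε₁ : ε < 1) {s : ℝ} {k n : ℕ} {p : ℝ}
    (hn : 0 < n) (hp : 0 < p)
    (hle : p ≤ (q : ℝ) ^ (-(s * k)) * (1 - ε + (q : ℝ) ^ s * ε) ^ n) :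
    s * (k / n) - Real.logb q (1 - ε + (q : ℝ) ^ s * ε) ≤ -(1 / (n : ℝ) * Real.logb q p) := by
  have hq1 : (1 : ℝ) < q := by exact_mod_cast hq
  have hq0 : (0 : ℝ) < q := by linarith
  have hn' : (0 : ℝ) < n := by exact_mod_cast hn
  have hZ : 0 < 1 - ε + (q : ℝ) ^ s * ε := by
    have : 0 < (q : ℝ) ^ s * ε := by positivity
    linarith
  have h := (Real.logb_le_logb hq1 hp (by positivity)).2 hle
  rw [Real.logb_mul (by positivity) (by positivity), Real.logb_rpow hq0 hq1.ne', Real.logb_pow] at h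
  have h2 := mul_le_mul_of_nonneg_left h (by positivity : 0 ≤ 1 / (n : ℝ))
  have h3 : 1 / (n : ℝ) * (-(s * k) + n * Real.logb q (1 - ε + (q : ℝ) ^ s * ε)) =
      -(s * (k / n)) + Real.logb q (1 - ε + (q : ℝ) ^ s * ε) := by field_simp
  linarith

/-- Change of measure: the `ε`-binomial mass at `i` is the `β`-binomial mass, at least `1 /
(2(n+1))`, times a likelihood ratio that supplies the divergence terms. -/
theorem le_tilted_exponent (hq : 1 < q) (hε₀ : 0 < ε) (hε₁ : ε < 1) {β c : ℝ} (hβ₀ : 0 < β)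
    (hβ₁ : β < 1) (hc : 0 < c) {i k n : ℕ} {p : ℝ} (hn : 0 < n) (hi : i ≤ n)
    (hb : 1 / (2 * ((n : ℝ) + 1)) ≤ n.choose i * β ^ i * (1 - β) ^ (n - i))
    (hle : c * ((n.choose i * ε ^ i * (1 - ε) ^ (n - i)) / (q : ℝ) ^ ((ℓ + 1) * (k - i))) ≤ p) :
    0 < p ∧ -(1 / (n : ℝ) * Real.logb q p) ≤
      -(Real.logb q (c / 2) / n) + Real.logb q ((n : ℝ) + 1) / n -
        (i / n) * Real.logb q (ε / β) - (1 - i / n) * Real.logb q ((1 - ε) / (1 - β)) +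
        (ℓ + 1) * max ((k : ℝ) / n - i / n) 0 := by
  have hq1 : (1 : ℝ) < q := by exact_mod_cast hq
  have hq0 : (0 : ℝ) < q := by linarith
  have hn' : (0 : ℝ) < n := by exact_mod_cast hn
  have hβ : 0 < 1 - β := by linarith
  have hε : 0 < 1 - ε := by linarith
  have h1 : c / 2 / ((n : ℝ) + 1) * ((ε / β) ^ i * ((1 - ε) / (1 - β)) ^ (n - i)) /
      (q : ℝ) ^ ((ℓ + 1) * (k - i)) ≤ p := by
    refine le_trans ?_ hle
    have h2 : (n.choose i * ε ^ i * (1 - ε) ^ (n - i) : ℝ) =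
        n.choose i * β ^ i * (1 - β) ^ (n - i) *
          ((ε / β) ^ i * ((1 - ε) / (1 - β)) ^ (n - i)) := by
      rw [div_pow, div_pow]
      field_simp
    have h3 : c / 2 / ((n : ℝ) + 1) = c * (1 / (2 * ((n : ℝ) + 1))) := by field_simp
    rw [h2, h3, mul_assoc c, mul_div_assoc c]
    gcongr
  have hp : 0 < p := lt_of_lt_of_le (by positivity) h1
  refine ⟨hp, ?_⟩
  have h := (Real.logb_le_logb hq1 (by positivity) hp).2 h1
  rw [Real.logb_div (by positivity) (by positivity), Real.logb_mul (by positivity) (by positivity),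
    Real.logb_div (by positivity) (by positivity), Real.logb_mul (by positivity) (by positivity),
    Real.logb_pow, Real.logb_pow, Real.logb_pow, Real.logb_self_eq_one hq1, mul_one,
    Nat.cast_sub hi] at h
  -- Truncated subtraction becomes the positive part.
  have hmax : (((k - i : ℕ) : ℝ)) / n = max ((k : ℝ) / n - i / n) 0 := by
    rw [← sub_div]
    rcases le_total i k with hik | hik
    · rw [Nat.cast_sub hik, max_eq_left]
      exact div_nonneg (sub_nonneg.2 (by exact_mod_cast hik)) hn'.le
    · rw [Nat.sub_eq_zero_of_le hik, Nat.cast_zero, zero_div, max_eq_right]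
      exact div_nonpos_of_nonpos_of_nonneg (sub_nonpos.2 (by exact_mod_cast hik)) hn'.le
  rw [← hmax]
  have h2 := mul_le_mul_of_nonneg_left h (by positivity : 0 ≤ 1 / (n : ℝ))
  refine (neg_le_neg h2).trans_eq ?_
  push_cast
  field_simp
  ring

/-- Squeeze: any pair `s`, `β` for which the Chernoff and tilted exponents coincide determines the
limit. -/
theorem hasErrorExponent_of_exponents_eq (hq : 1 < q) (hε₀ : 0 < ε) (hε₁ : ε < 1)
    (hm : Tendsto (fun n : ℕ => (m n : ℝ) / (n : ℝ)) atTop (𝓝 (1 - R)))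
    {s β c T : ℝ} (hβ₀ : 0 < β) (hβ₁ : β < 1) (hc : 0 < c)
    (hupper : ∀ n, P n ≤ (q : ℝ) ^ (-(s * m n)) * (1 - ε + (q : ℝ) ^ s * ε) ^ n)
    (hlower : ∀ n i, ℓ < i → c * ((n.choose i * ε ^ i * (1 - ε) ^ (n - i)) /
      (q : ℝ) ^ ((ℓ + 1) * (m n - i))) ≤ P n)
    (hs : s * (1 - R) - Real.logb q (1 - ε + (q : ℝ) ^ s * ε) = T)
    (hβ : -(β * Real.logb q (ε / β)) - (1 - β) * Real.logb q ((1 - ε) / (1 - β)) +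
      (ℓ + 1) * max (1 - R - β) 0 = T) :
    HasErrorExponent q P T := by
  obtain ⟨i, hi, hatom⟩ := exists_binomial_atoms hβ₀ hβ₁
  have hl : Tendsto (fun n : ℕ => s * ((m n : ℝ) / n) -
      Real.logb q (1 - ε + (q : ℝ) ^ s * ε)) atTop (𝓝 T) := by
    rw [← hs]
    exact (hm.const_mul s).sub_const _
  have hu : Tendsto (fun n : ℕ => -(Real.logb q (c / 2) / n) + Real.logb q ((n : ℝ) + 1) / n -
      ((i n : ℝ) / n) * Real.logb q (ε / β) -
        (1 - (i n : ℝ) / n) * Real.logb q ((1 - ε) / (1 - β)) +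
        (ℓ + 1) * max ((m n : ℝ) / n - i n / n) 0) atTop (𝓝 T) := by
    have h := (((((tendsto_const_div_atTop_nhds_zero_nat (Real.logb q (c / 2))).neg.add
      (tendsto_logb_add_one_div q)).sub (hi.mul_const (Real.logb q (ε / β)))).sub
      ((hi.const_sub 1).mul_const (Real.logb q ((1 - ε) / (1 - β))))).add
      (((hm.sub hi).max (tendsto_const_nhds (x := (0 : ℝ)))).const_mul ((ℓ : ℝ) + 1)))
    convert h using 2
    rw [← hβ]
    ring
  -- Since `i n / n → β > 0`, the weights tend to infinity and eventually satisfy the restriction in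
  -- `hlower`.
  have hbig : ∀ᶠ n : ℕ in atTop, ℓ < i n := by
    have h1 := hi.pos_mul_atTop hβ₀ tendsto_natCast_atTop_atTop
    filter_upwards [h1.eventually_gt_atTop (ℓ : ℝ), eventually_gt_atTop 0] with n hn hn0
    rw [div_mul_cancel₀ _ (by exact_mod_cast hn0.ne')] at hn
    exact_mod_cast hn
  have hbounds : ∀ᶠ n : ℕ in atTop, 0 < n ∧ ℓ < i n := (eventually_gt_atTop 0).and hbig
  refine tendsto_of_tendsto_of_tendsto_of_le_of_le' hl hu ?_ ?_
  · filter_upwards [hbounds] with n hn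
    have h := le_tilted_exponent hq hε₀ hε₁ hβ₀ hβ₁ hc hn.1 (hatom n hn.1).1 (hatom n hn.1).2
      (hlower n (i n) hn.2)
    exact chernoff_exponent_le hq hε₀ hε₁ hn.1 h.1 (hupper n)
  · filter_upwards [hbounds] with n hn
    exact (le_tilted_exponent hq hε₀ hε₁ hβ₀ hβ₁ hc hn.1 (hatom n hn.1).1 (hatom n hn.1).2
      (hlower n (i n) hn.2)).2

theorem hasErrorExponent_of_bounds (hq : 1 < q) (hε₀ : 0 < ε) (hε₁ : ε < 1) (hR₀ : 0 < R)
    (hR₁ : R < 1) (hm : Tendsto (fun n : ℕ => (m n : ℝ) / (n : ℝ)) atTop (𝓝 (1 - R)))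
    {c : ℝ} (hc : 0 < c)
    (hupper : ∀ n (s : ℝ), 0 ≤ s → s ≤ ℓ + 1 →
      P n ≤ (q : ℝ) ^ (-(s * m n)) * (1 - ε + (q : ℝ) ^ s * ε) ^ n)
    (hlower : ∀ n i, ℓ < i → c * ((n.choose i * ε ^ i * (1 - ε) ^ (n - i)) /
      (q : ℝ) ^ ((ℓ + 1) * (m n - i))) ≤ P n) :
    HasErrorExponent q P (exponentFormula q ℓ ε R) := by
  have hq1 : (1 : ℝ) < q := by exact_mod_cast hq
  have hq0 : (0 : ℝ) < q := by linarith
  have hε : 0 < 1 - ε := by linarith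
  have hR : 0 < 1 - R := by linarith
  set Q : ℝ := (q : ℝ) ^ (ℓ + 1) with hQ
  have hQ0 : 0 < Q := by positivity
  have hlogQ : Real.logb q Q = ℓ + 1 := by
    rw [hQ, Real.logb_pow, Real.logb_self_eq_one hq1]
    push_cast
    ring
  have hℓ : (0 : ℝ) ≤ ℓ + 1 := by positivity
  unfold exponentFormula
  rw [← hQ]
  split_ifs with h1 h2
  -- Typical erasure patterns already exceed the redundancy, as `ε ≥ 1 - R`, so no tilting is
  -- needed.
  · refine hasErrorExponent_of_exponents_eq (s := 0) (β := ε) hq hε₀ hε₁ hm hε₀ hε₁ hc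
      (fun n => hupper n 0 le_rfl hℓ) hlower ?_ ?_
    · simp
    · rw [div_self hε₀.ne', div_self hε.ne', max_eq_right (by linarith)]
      simp
  · push Not at h1
    rw [div_lt_iff₀ (by positivity)] at h2
    -- `x = q^s` at the stationary point of `s(1-R) - log_q(1-ε+q^s ε)`, where the tilted mean is `1
    -- - R`. The two bounds on `R` in this regime give `0 ≤ s ≤ ℓ + 1`.
    set x : ℝ := (1 - R) * (1 - ε) / (R * ε) with hx
    have hx0 : 0 < x := by positivity
    have hqx : (q : ℝ) ^ Real.logb q x = x := Real.rpow_logb hq0 hq1.ne' hx0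
    have hZ : 1 - ε + x * ε = (1 - ε) / R := by
      rw [hx]
      field_simp
      ring
    refine hasErrorExponent_of_exponents_eq (s := Real.logb q x) (β := 1 - R) hq hε₀ hε₁ hm hR
      (by linarith) hc (fun n => hupper n _ (Real.logb_nonneg hq1 ?_) ?_) hlower ?_ ?_
    · rw [hx, le_div_iff₀ (by positivity)]
      nlinarith
    · rw [← hlogQ]
      refine (Real.logb_le_logb hq1 hx0 hQ0).2 ?_
      rw [hx, div_le_iff₀ (by positivity)]
      nlinarith
    · rw [hqx, hZ, hx, Real.logb_div (by positivity) (by positivity),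
        Real.logb_mul hR.ne' hε.ne', Real.logb_mul hR₀.ne' hε₀.ne',
        Real.logb_div hε.ne' hR₀.ne', Real.logb_div hR.ne' hε₀.ne', Real.logb_div hR₀.ne' hε.ne']
      ring
    · rw [sub_sub_cancel, sub_self, max_self, Real.logb_div hε₀.ne' hR.ne',
        Real.logb_div hε.ne' hR₀.ne', Real.logb_div hR.ne' hε₀.ne', Real.logb_div hR₀.ne' hε.ne']
      ring
  · push Not at h1 h2
    set Z : ℝ := 1 - ε + Q * ε with hZ
    have hZ0 : 0 < Z := by positivity
    have hqs : (q : ℝ) ^ ((ℓ : ℝ) + 1) = Q := by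
      rw [hQ, ← Real.rpow_natCast]
      push_cast
      rfl
    have h1β : 1 - Q * ε / Z = (1 - ε) / Z := by
      rw [eq_div_iff hZ0.ne', sub_mul, div_mul_cancel₀ _ hZ0.ne', hZ]
      ring
    -- The stationary point is at or beyond `ℓ + 1`, so `s` takes the endpoint value. The bound on
    -- `R` says `β ≤ 1 - R`, which makes the positive part the first argument of `max`.
    refine hasErrorExponent_of_exponents_eq (s := ℓ + 1) (β := Q * ε / Z) hq hε₀ hε₁ hm
      (by positivity) ?_ hc (fun n => hupper n _ hℓ le_rfl) hlower ?_ ?_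
    · rw [← sub_pos, h1β]
      positivity
    · rw [hqs]
    · have h3 : ε / (Q * ε / Z) = Z / Q := by field_simp
      have h4 : (1 - ε) / ((1 - ε) / Z) = Z := by field_simp
      rw [max_eq_left (by linarith), h1β, h3, h4, ← h1β, Real.logb_div hZ0.ne' hQ0.ne', hlogQ]
      ring

end Exponent

end ErasureChannel

/-! ### The exponents of the three decoders -/

open ErasureChannel

theorem theorem2 {F : Type*} [Field F] [Fintype F] (ε R : ℝ)
    (hε₀ : 0 < ε) (hε₁ : ε < 1) (hR₀ : 0 < R) (hR₁ : R < 1)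
    (m : ℕ → ℕ) (hm : Tendsto (fun n : ℕ => (m n : ℝ) / (n : ℝ)) atTop (𝓝 (1 - R))) :
    (∀ ℓ : ℕ, ErasureChannel.HasErrorExponent (Fintype.card F)
        (fun n => ErasureChannel.avgListFailureProb F (m n) n ℓ ε)
        (ErasureChannel.exponentFormula (Fintype.card F) ℓ ε R)) ∧
    ErasureChannel.HasErrorExponent (Fintype.card F)
        (fun n => ErasureChannel.avgUnambiguousFailureProb F (m n) n ε)
        (ErasureChannel.exponentFormula (Fintype.card F) 0 ε R) ∧
    ErasureChannel.HasErrorExponent (Fintype.card F)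
        (fun n => ErasureChannel.avgMLErrorProb F (m n) n ε)
        (ErasureChannel.exponentFormula (Fintype.card F) 0 ε R) := by
  have hq : 1 < Fintype.card F := Fintype.one_lt_card
  have hc : ∀ ℓ : ℕ, 0 < 1 / (2 * (Fintype.card F : ℝ) ^ ((ℓ + 1) * (ℓ + 1))) := fun ℓ => by
    have : (0 : ℝ) < Fintype.card F := Nat.cast_pos.2 Fintype.card_pos
    positivity
  have hld : ∀ ℓ : ℕ, HasErrorExponent (Fintype.card F)
      (fun n => avgListFailureProb F (m n) n ℓ ε) (exponentFormula (Fintype.card F) ℓ ε R) :=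
    fun ℓ => hasErrorExponent_of_bounds hq hε₀ hε₁ hR₀ hR₁ hm (hc ℓ)
      (fun n s hs₀ hs₁ => avgListFailureProb_le (m n) n ℓ hε₀ hε₁ hs₀ hs₁)
      (fun n i hi => le_avgListFailureProb (m n) n ℓ hε₀ hε₁ hi)
  refine ⟨hld, ?_, ?_⟩
  · simpa only [avgUnambiguousFailureProb_eq] using hld 0
  -- The factor 1/2 lost to random tie-breaking is absorbed into the constant of the lower bound.
  · refine hasErrorExponent_of_bounds hq hε₀ hε₁ hR₀ hR₁ hm (half_pos (hc 0))
      (fun n s hs₀ hs₁ => (avgMLErrorProb_bounds (m n) n hε₀ hε₁).2.trans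
        (avgListFailureProb_le (m n) n 0 hε₀ hε₁ hs₀ hs₁))
      (fun n i hi => le_trans ?_ (avgMLErrorProb_bounds (m n) n hε₀ hε₁).1)
    have h := mul_le_mul_of_nonneg_left (le_avgListFailureProb (F := F) (m n) n 0 hε₀ hε₁ hi)
      (by norm_num : (0 : ℝ) ≤ 1 / 2)
    refine h.trans' (le_of_eq ?_)
    ring
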